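/- Let $\bar S$ be a finite non-empty set of options (single items or bundles; one unit of each) with real salvage values $\xi_i$, and let $\Omega$ be a finite set of customer types. In each period a customer arrives with probability $\mu\in(0,1]$, and the type $X$ of an arriving customer has a fixed probability distribution on $\Omega$. Customers choose according to a multinomial logit model: if the options in $S\subseteq\bar S$ are offered at prices $p\in\mathbb R^{S}$, a customer of type $\omega$ selects $i\in S$ with probability $$\rho_i^\omega(p,S)=\frac{e^{q_i^\omega+\beta_p p_i}}{1+\sum_{j\in S}e^{q_j^\omega+\beta_p p_j}},$$ where $q_i^\omega\in\mathbb R$ and the price sensitivity $\beta_p<0$ is the same for all types and options. The optimal expected revenue $V^*_t(S)$ with $t$ periods to go and available options $S$ is defined by $V_0^*(S)=\sum_{i\in S}\xi_i$ and, for $t\ge 1$, $$V_t^*(S)=V_{t-1}^*(S)+\mu\,\mathbb E_X\Big[\sup_{p\in\mathbb R^{S}}\sum_{i\in S}\rho_i^X(p,S)\big(p_i-V_{t-1}^*(S)+V_{t-1}^*(S\setminus\{i\})\big)\Big].$$ The fluid approximation $V_T^{\mathrm{Fluid}}(\bar S)$ is the optimal value of the problem $$\sup_{\rho}\ \mu T\sum_{i\in\bar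 S}\mathbb E_X\big[\rho_i^X\,(p_i^X(\rho^X)-\xi_i)\big]+\sum_{i\in\bar S}\xi_i$$ over $\rho=(\rho_i^\omega)$ with $\rho_i^\omega\in(0,1)$, subject to $\mu T\,\mathbb E_X[\rho_i^X]\le 1$ for all $i\in\bar S$ and $\sum_{i\in\bar S}\rho_i^\omega\le 1$ for all $\omega\in\Omega$, where $p^\omega(\rho^\omega)$ is the unique price vector with $\rho^\omega(p^\omega(\rho^\omega),\bar S)=\rho^\omega$, that is, $p_i^\omega(\rho^\omega)=\frac1{\beta_p}\big(\ln\rho_i^\omega-\ln(1-\sum_{j\in\bar S}\rho_j^\omega)-q_i^\omega\big)$ (points $\rho$ with $\sum_i\rho_i^\omega=1$ for some $\omega$ are induced by no price vector and do not count). Then the fluid approximation is not asymptotically optimal: $V_T^{\mathrm{Fluid}}(\bar S)-V_T^*(\bar S)$ does not converge to $0$ as $T\to\infty$ ($T\in\mathbb N$). Moreover, the limit of this difference exists and $$\lim_{T\to\infty}\big(V_T^{\mathrm{Fluid}}(\bar S)-V_T^*(\bar S)\big)\ \ge\ -\frac{|\bar S|}{\beta_p}\ >\ 0 .$$ -/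

import Mathlib

open Filter Topology

/-- The data of the unique-items pricing problem under the multinomial logit (MNL) model:
`ι` indexes the options and `Ω` the (finitely many) customer types. -/
structure UIPModel (ι Ω : Type*) where
  /-- probability that a customer arrives in a period -/
  mu : ℝ
  /-- price sensitivity -/
  beta : ℝ
  /-- law of the type `X` of an arriving customer -/
  typeLaw : PMF Ω
  /-- `quality ω i` is the quality of option `i` perceived by customers of type `ω` -/
  quality : Ω → ι → ℝ
  /-- salvage values of the options -/
  salvage : ι → ℝ

namespace UIPModel

variable {ι Ω : Type*} (M : UIPModel ι Ω)

/-- Expectation over the customer type. -/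
noncomputable def expect [Fintype Ω] (g : Ω → ℝ) : ℝ :=
  ∑ ω, (M.typeLaw ω).toReal * g ω

/-- MNL probability that a customer of type `ω` selects option `i`, when the options in `S` are
offered at prices `p` (only the prices of the options in `S` matter). -/
noncomputable def choiceProb (ω : Ω) (S : Finset ι) (p : ι → ℝ) (i : ι) : ℝ :=
  Real.exp (M.quality ω i + M.beta * p i) /
    (1 + ∑ j ∈ S, Real.exp (M.quality ω j + M.beta * p j))

/-- Single-stage revenue from a customer of type `ω` at prices `p`, net of the marginal values
`Δ`. -/
noncomputable def stageRevenue (ω : Ω) (S : Finset ι) (Δ p : ι → ℝ) : ℝ :=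
  ∑ i ∈ S, M.choiceProb ω S p i * (p i - Δ i)

/-- Optimal value `R` of the single-stage single-type pricing problem. -/
noncomputable def stageOpt (ω : Ω) (S : Finset ι) (Δ : ι → ℝ) : ℝ :=
  sSup (Set.range (M.stageRevenue ω S Δ))

/-- The value function `V*`: `M.optValue t S` is the optimal expected revenue with `t` periods to
go when the options in `S` are available, given by the Bellman recursion. -/
noncomputable def optValue [Fintype Ω] [DecidableEq ι] : ℕ → Finset ι → ℝ
  | 0, S => ∑ i ∈ S, M.salvage i
  | t + 1, S => optValue t S + M.mu * M.expect fun ω =>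
      M.stageOpt ω S fun i => optValue t S - optValue t (S.erase i)

/-- Constraints of the fluid problem on the selection probabilities `ρ`: each of them is in
`(0, 1)`, every option is sold at most once in expectation over the `T` periods, and the
selection probabilities of each type sum to at most one. -/
structure FluidFeasible [Fintype Ω] (S : Finset ι) (T : ℕ) (ρ : Ω → ι → ℝ) : Prop where
  mem_Ioo : ∀ ω, ∀ i ∈ S, ρ ω i ∈ Set.Ioo (0 : ℝ) 1
  inventory : ∀ i ∈ S, M.mu * T * M.expect (fun ω => ρ ω i) ≤ 1
  sum_le_one : ∀ ω, ∑ i ∈ S, ρ ω i ≤ 1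

/-- `p` is a price vector `p(ρ)` that induces the selection probabilities `ρ` for every type. It
is unique on `S`; see `Induces.price_eq`. (None exists if `∑ i ∈ S, ρ ω i = 1`: the no-purchase
probability is then zero, and the corresponding prices would be `-∞`.) -/
def Induces (S : Finset ι) (p ρ : Ω → ι → ℝ) : Prop :=
  ∀ ω, ∀ i ∈ S, M.choiceProb ω S (p ω) i = ρ ω i

/-- Objective of the fluid problem. -/
noncomputable def fluidObjective [Fintype Ω] (S : Finset ι) (T : ℕ) (p ρ : Ω → ι → ℝ) : ℝ :=
  M.mu * T * ∑ i ∈ S, M.expect (fun ω => ρ ω i * (p ω i - M.salvage i)) + ∑ i ∈ S, M.salvage i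

/-- The values taken by the objective of the fluid problem at feasible points. -/
def fluidValues [Fintype Ω] (S : Finset ι) (T : ℕ) : Set ℝ :=
  {v | ∃ ρ p : Ω → ι → ℝ, M.FluidFeasible S T ρ ∧ M.Induces S p ρ ∧ v = M.fluidObjective S T p ρ}

/-- Optimal value `V^Fluid` of the fluid problem. -/
noncomputable def fluidValue [Fintype Ω] (S : Finset ι) (T : ℕ) : ℝ :=
  sSup (M.fluidValues S T)

/-! Sanity checks: the inverse demand function is the usual one, and both suprema are suprema of
non-empty sets that are bounded above. -/

theorem denom_pos (ω : Ω) (S : Finset ι) (p : ι → ℝ) :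
    0 < 1 + ∑ j ∈ S, Real.exp (M.quality ω j + M.beta * p j) := by
  have : 0 ≤ ∑ j ∈ S, Real.exp (M.quality ω j + M.beta * p j) :=
    Finset.sum_nonneg fun j _ => (Real.exp_pos _).le
  linarith

theorem sum_choiceProb (ω : Ω) (S : Finset ι) (p : ι → ℝ) :
    1 - ∑ i ∈ S, M.choiceProb ω S p i =
      1 / (1 + ∑ j ∈ S, Real.exp (M.quality ω j + M.beta * p j)) := by
  have h := (M.denom_pos ω S p).ne'
  simp only [choiceProb, ← Finset.sum_div]
  field_simp
  ring

theorem Induces.price_eq {M : UIPModel ι Ω} (hβ : M.beta < 0) {S : Finset ι}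
    {p ρ : Ω → ι → ℝ} (h : M.Induces S p ρ) (ω : Ω) {i : ι} (hi : i ∈ S) :
    p ω i = 1 / M.beta *
      (Real.log (ρ ω i) - Real.log (1 - ∑ j ∈ S, ρ ω j) - M.quality ω i) := by
  have hd := M.denom_pos ω S (p ω)
  have hs : ∑ j ∈ S, ρ ω j = ∑ j ∈ S, M.choiceProb ω S (p ω) j :=
    Finset.sum_congr rfl fun j hj => (h ω j hj).symm
  rw [hs, sum_choiceProb, ← h ω i hi, choiceProb,
    Real.log_div (Real.exp_ne_zero _) hd.ne', Real.log_exp, one_div (1 + _), Real.log_inv]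
  have := hβ.ne
  field_simp
  ring

theorem choiceProb_mul_le (hβ : M.beta < 0) (ω : Ω) (S : Finset ι) (p : ι → ℝ) (i : ι) (d : ℝ) :
    M.choiceProb ω S p i * (p i - d) ≤
      Real.exp (M.quality ω i + M.beta * d) / (-M.beta) := by
  have hd := M.denom_pos ω S p
  have hpos : 0 < Real.exp (M.quality ω i + M.beta * d) / (-M.beta) :=
    div_pos (Real.exp_pos _) (by linarith)
  rcases le_or_gt (p i - d) 0 with h | h
  · exact (mul_nonpos_of_nonneg_of_nonpos (div_pos (Real.exp_pos _) hd).le h).trans hpos.le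
  · have h1 : M.choiceProb ω S p i ≤ Real.exp (M.quality ω i + M.beta * p i) := by
      refine div_le_self (Real.exp_pos _).le ?_
      have : 0 ≤ ∑ j ∈ S, Real.exp (M.quality ω j + M.beta * p j) :=
        Finset.sum_nonneg fun j _ => (Real.exp_pos _).le
      linarith
    refine (mul_le_mul_of_nonneg_right h1 h.le).trans ?_
    rw [le_div_iff₀ (by linarith)]
    have e : M.quality ω i + M.beta * p i =
        (M.quality ω i + M.beta * d) + -(-M.beta * (p i - d)) := by ring
    rw [e, Real.exp_add, Real.exp_neg, mul_assoc, mul_assoc]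
    refine mul_le_of_le_one_right (Real.exp_pos _).le ?_
    rw [← div_eq_inv_mul, div_le_one (Real.exp_pos _)]
    have := Real.add_one_le_exp (-M.beta * (p i - d))
    linarith

theorem isLUB_stageOpt (hβ : M.beta < 0) (ω : Ω) (S : Finset ι) (Δ : ι → ℝ) :
    IsLUB (Set.range (M.stageRevenue ω S Δ)) (M.stageOpt ω S Δ) := by
  refine isLUB_csSup (Set.range_nonempty _) ?_
  refine ⟨∑ i ∈ S, Real.exp (M.quality ω i + M.beta * Δ i) / (-M.beta), ?_⟩
  rintro _ ⟨p, rfl⟩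
  exact Finset.sum_le_sum fun i _ => M.choiceProb_mul_le hβ ω S p i (Δ i)

theorem fluidValues_bddAbove [Fintype Ω] (hμ : 0 < M.mu) (hβ : M.beta < 0) (S : Finset ι)
    (T : ℕ) : BddAbove (M.fluidValues S T) := by
  refine ⟨M.mu * T * ∑ i ∈ S, M.expect (fun ω =>
    Real.exp (M.quality ω i + M.beta * M.salvage i) / (-M.beta)) + ∑ i ∈ S, M.salvage i, ?_⟩
  rintro _ ⟨ρ, p, -, hp, rfl⟩
  unfold fluidObjective expect
  gcongr with i hi ω
  simp only [← hp ω i hi]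
  exact M.choiceProb_mul_le hβ ω S (p ω) i (M.salvage i)

theorem fluidValues_nonempty [Fintype Ω] (hβ : M.beta < 0) (S : Finset ι)
    (T : ℕ) : (M.fluidValues S T).Nonempty := by
  have hev : ∀ᶠ c : ℝ in atTop, ∀ i ∈ S,
      M.mu * T * M.expect (fun ω => M.choiceProb ω S (fun _ => c) i) < 1 := by
    rw [Filter.eventually_all_finset]
    intro i _
    have ht : ∀ ω j, Tendsto (fun c : ℝ => Real.exp (M.quality ω j + M.beta * c)) atTop (𝓝 0) :=
      fun ω j => Real.tendsto_exp_atBot.comp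
        (tendsto_atBot_add_const_left _ _ (tendsto_id.const_mul_atTop_of_neg hβ))
    have h1 : ∀ ω, Tendsto (fun c : ℝ => M.choiceProb ω S (fun _ => c) i) atTop (𝓝 0) := by
      intro ω
      have := (ht ω i).div (tendsto_const_nhds (x := (1 : ℝ)) |>.add
        (tendsto_finsetSum S fun j _ => ht ω j)) (by simp)
      simpa [choiceProb, Pi.div_def] using this
    have h2 : Tendsto (fun c : ℝ => M.mu * T * M.expect
        (fun ω => M.choiceProb ω S (fun _ => c) i)) atTop (𝓝 0) := by
      have := (tendsto_finsetSum Finset.univ fun ω _ =>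
        (h1 ω).const_mul (M.typeLaw ω).toReal).const_mul (M.mu * T)
      simpa [expect] using this
    exact h2.eventually (gt_mem_nhds one_pos)
  obtain ⟨c, hc⟩ := hev.exists
  have hpos : ∀ ω i, 0 < M.choiceProb ω S (fun _ => c) i :=
    fun ω i => div_pos (Real.exp_pos _) (M.denom_pos _ _ _)
  have hsum : ∀ ω, ∑ i ∈ S, M.choiceProb ω S (fun _ => c) i < 1 := by
    intro ω
    have h := M.sum_choiceProb ω S (fun _ => c)
    have h' := one_div_pos.mpr (M.denom_pos ω S (fun _ => c))
    linarith
  refine ⟨_, fun ω => M.choiceProb ω S (fun _ => c), fun _ _ => c, ⟨?_, ?_, ?_⟩, ?_, rfl⟩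
  · intro ω i hi
    refine ⟨hpos ω i, lt_of_le_of_lt ?_ (hsum ω)⟩
    exact Finset.single_le_sum (f := fun i => M.choiceProb ω S (fun _ => c) i)
      (fun j _ => (hpos ω j).le) hi
  · exact fun i hi => (hc i hi).le
  · exact fun ω => (hsum ω).le
  · exact fun _ _ _ => rfl

theorem isLUB_fluidValue [Fintype Ω] (hμ : 0 < M.mu) (hβ : M.beta < 0) (S : Finset ι) (T : ℕ) :
    IsLUB (M.fluidValues S T) (M.fluidValue S T) :=
  isLUB_csSup (M.fluidValues_nonempty hβ S T) (M.fluidValues_bddAbove hμ hβ S T)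

end UIPModel

/-! Write `b = -β` and `C_i` for `meanAttr i`. The limit is in fact exactly `|S| / b`, obtained by
expanding both values up to `o(1)`. For the dynamic program, put `W_t(S) = exp (b V_t(S))`. The
scaled single-stage optimum lies between `A / (1 + A)` and `A`, where `A = ∑ i, exp (q_i + β Δ_i) /
e`. Since `exp (β Δ_i)` is the ratio `W_t(S \ {i}) / W_t(S)`, the Bellman recursion becomes, to
first order, the linear system `W_{t+1}(S) - W_t(S) ≈ ∑ i, (μ C_i / e) W_t(S \ {i})`. Induction on
`S` gives `W_t(S) ∼ t ^ |S| ∏ i, μ C_i / e` (`tendsto_expValue_div_pow`), hence `b V_t(S) = ∑ i, log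
(μ t C_i) - |S| + o(1)`; the salvage values leave no trace. For the fluid problem, Lagrangian
duality bounds `b` times the value above by `∑ i, log (μ T C_i)` for large `T`, and the prices `log
(μ T C_i) / b` attain this up to `O(log T / T)` (`tendsto_neg_beta_mul_fluidValue_sub`). The factors
`1 / e` account for the gap of one unit per option. -/

/-! ### Asymptotics of real sequences with prescribed increments. -/

theorem tendsto_succ_div_self : Tendsto (fun t : ℕ => ((t : ℝ) + 1) / t) atTop (𝓝 1) := by
  have h := (tendsto_inv_atTop_nhds_zero_nat (𝕜 := ℝ)).const_add 1
  rw [add_zero] at h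
  refine h.congr' ?_
  filter_upwards [eventually_gt_atTop 0] with t ht
  have : (t : ℝ) ≠ 0 := by positivity
  field_simp

theorem tendsto_succ_pow_sub_pow_div (n : ℕ) :
    Tendsto (fun t : ℕ => (((t : ℝ) + 1) ^ (n + 1) - (t : ℝ) ^ (n + 1)) / (t : ℝ) ^ n) atTop
      (𝓝 (n + 1)) := by
  have h : Tendsto (fun t : ℕ => ∑ i ∈ Finset.range (n + 1), (((t : ℝ) + 1) / t) ^ i) atTop
      (𝓝 (∑ i ∈ Finset.range (n + 1), (1 : ℝ) ^ i)) :=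
    tendsto_finsetSum _ fun i _ => tendsto_succ_div_self.pow i
  simp only [one_pow, Finset.sum_const, Finset.card_range, nsmul_eq_mul, mul_one,
    Nat.cast_add, Nat.cast_one] at h
  refine h.congr' ?_
  filter_upwards [eventually_gt_atTop 0] with t ht
  have ht' : (t : ℝ) ≠ 0 := by positivity
  have hg := geom_sum₂_mul ((t : ℝ) + 1) (t : ℝ) (n + 1)
  rw [add_sub_cancel_left, mul_one] at hg
  rw [← hg, Finset.sum_div]
  refine Finset.sum_congr rfl fun i hi => ?_
  have hi' : i ≤ n := Nat.lt_succ_iff.1 (Finset.mem_range.1 hi)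
  rw [Nat.add_sub_cancel, div_pow, div_eq_div_iff (pow_ne_zero _ ht') (pow_ne_zero _ ht'),
    mul_assoc, ← pow_add, Nat.sub_add_cancel hi']

/-- Stolz–Cesàro for comparison with a power. -/
theorem tendsto_div_pow_succ_of_tendsto_sub_div_pow {v : ℕ → ℝ} {n : ℕ} {G : ℝ}
    (h : Tendsto (fun t => (v (t + 1) - v t) / (t : ℝ) ^ n) atTop (𝓝 ((n + 1) * G))) :
    Tendsto (fun t => v t / (t : ℝ) ^ (n + 1)) atTop (𝓝 G) := by
  set g : ℕ → ℝ := fun t => ((t : ℝ) + 1) ^ (n + 1) - (t : ℝ) ^ (n + 1) with hg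
  have hpow : ∀ t : ℕ, (t : ℝ) ^ n ≤ g t := by
    intro t
    have h0 : (0 : ℝ) ≤ t := t.cast_nonneg
    have h1 : (t : ℝ) ^ n ≤ ((t : ℝ) + 1) ^ n := pow_le_pow_left₀ h0 (by linarith) n
    have h2 : (t : ℝ) ^ n * (t + 1) ≤ ((t : ℝ) + 1) ^ n * (t + 1) := by gcongr
    simp only [hg, pow_succ]
    linarith
  have hg0 : 0 ≤ g := fun t => le_trans (by positivity) (hpow t)
  have hsum : ∀ t, ∑ s ∈ Finset.range t, g s = (t : ℝ) ^ (n + 1) := by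
    intro t
    have := Finset.sum_range_sub (fun s : ℕ => (s : ℝ) ^ (n + 1)) t
    simpa [hg] using this
  have hv : ∀ t, ∑ s ∈ Finset.range t, (v (s + 1) - v s - G * g s) =
      v t - v 0 - G * (t : ℝ) ^ (n + 1) := by
    intro t
    rw [Finset.sum_sub_distrib, Finset.sum_range_sub, ← Finset.mul_sum, hsum]
  have hdiv : Tendsto (fun t => (v (t + 1) - v t - G * g t) / (t : ℝ) ^ n) atTop (𝓝 0) := by
    have := h.sub ((tendsto_succ_pow_sub_pow_div n).const_mul G)
    rw [show ((n : ℝ) + 1) * G - G * (n + 1) = 0 by ring] at this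
    refine this.congr fun t => ?_
    simp only [hg]
    ring
  have htop : Tendsto (fun t : ℕ => (t : ℝ) ^ (n + 1)) atTop atTop :=
    (tendsto_pow_atTop n.succ_ne_zero).comp tendsto_natCast_atTop_atTop
  -- The increments of `v - G t ^ (n + 1)` are negligible against those of `t ^ (n + 1)`. As the
  -- latter are nonnegative with divergent sum, negligibility passes to partial sums.
  have ho : (fun t => v (t + 1) - v t - G * g t) =o[atTop] g := by
    have h1 : (fun t => v (t + 1) - v t - G * g t) =o[atTop] fun t : ℕ => (t : ℝ) ^ n := by
      refine (Asymptotics.isLittleO_iff_tendsto' ?_).2 hdiv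
      filter_upwards [eventually_gt_atTop 0] with t ht h0
      exact absurd h0 (by positivity)
    refine h1.trans_isBigO (Asymptotics.IsBigO.of_norm_le fun t => ?_)
    rw [Real.norm_of_nonneg (by positivity)]
    exact hpow t
  have hs := ho.sum_range hg0 (by simpa only [hsum] using htop)
  simp only [hsum, hv] at hs
  have h3 := hs.tendsto_div_nhds_zero.add ((htop.const_div_atTop (v 0)).add_const G)
  rw [zero_add, zero_add] at h3
  refine h3.congr' ?_
  filter_upwards [eventually_gt_atTop 0] with t ht
  have : (t : ℝ) ^ (n + 1) ≠ 0 := by positivity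
  field_simp
  ring

/-- Since `x / (1 + K x)` is increasing, the recursion contracts by a uniform factor while `d t ≥
δ`; below `δ`, one step cannot exceed `2 δ` once `r t < 2`. It serves to show that the relative
increments `α t / v t` vanish. -/
theorem tendsto_zero_of_le_mul_div_one_add {d r : ℕ → ℝ} {K : ℝ} (hK : 0 ≤ K)
    (hd : ∀ t, 0 ≤ d t) (hr : Tendsto r atTop (𝓝 1))
    (h : ∀ t, d (t + 1) ≤ r t * (d t / (1 + d t / (1 + K * d t)))) :
    Tendsto d atTop (𝓝 0) := by
  rw [Metric.tendsto_atTop]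
  intro ε hε
  set δ := ε / 3 with hδ
  have hδ0 : 0 < δ := by positivity
  set κ := 1 / (1 + δ / (1 + K * δ)) with hκ
  have hκ1 : κ < 1 := by
    rw [hκ, div_lt_one (by positivity)]
    have : 0 < δ / (1 + K * δ) := by positivity
    linarith
  have hκ0 : 0 < κ := by positivity
  -- `κ` is the contraction factor at `d t = δ`; the slack up to `κ'` absorbs `r t`, which is only
  -- close to `1`.
  obtain ⟨κ', hκκ', hκ'1⟩ := exists_between hκ1
  have hκ'0 : 0 < κ' := hκ0.trans hκκ'
  have hev : ∀ᶠ t in atTop, 0 < r t ∧ r t < 2 ∧ r t * κ < κ' := by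
    have h1 := (hr.mul_const κ).eventually (gt_mem_nhds (show 1 * κ < κ' by simpa using hκκ'))
    filter_upwards [h1, hr.eventually (gt_mem_nhds one_lt_two),
      hr.eventually (lt_mem_nhds one_pos)] with t a b c
    exact ⟨c, b, a⟩
  obtain ⟨t₀, ht₀⟩ := eventually_atTop.1 hev
  have hstep : ∀ t ≥ t₀, d (t + 1) ≤ max (2 * δ) (κ' * d t) := by
    intro t ht
    obtain ⟨r0, r2, rκ⟩ := ht₀ t ht
    have hdt := hd t
    rcases le_total (d t) δ with hle | hle
    · refine le_max_of_le_left ((h t).trans ?_)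
      have h1 : d t / (1 + d t / (1 + K * d t)) ≤ d t := by
        refine div_le_self hdt ?_
        have : 0 ≤ d t / (1 + K * d t) := by positivity
        linarith
      exact mul_le_mul r2.le (h1.trans hle) (by positivity) (by norm_num)
    · refine le_max_of_le_right ((h t).trans ?_)
      have h1 : δ / (1 + K * δ) ≤ d t / (1 + K * d t) := by
        rw [div_le_div_iff₀ (by positivity) (by positivity)]
        nlinarith
      have h2 : d t / (1 + d t / (1 + K * d t)) ≤ κ * d t := by
        rw [hκ, one_div_mul_eq_div]
        gcongr
      calc r t * (d t / (1 + d t / (1 + K * d t))) ≤ r t * (κ * d t) := by gcongr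
        _ = r t * κ * d t := by ring
        _ ≤ κ' * d t := by gcongr
  have hind : ∀ k, d (t₀ + k) ≤ max (2 * δ) (κ' ^ k * d t₀) := by
    intro k
    induction k with
    | zero => simp
    | succ k ih =>
      refine (hstep (t₀ + k) (Nat.le_add_right _ _)).trans (max_le (le_max_left _ _) ?_)
      rcases le_max_iff.1 ih with h1 | h1
      · refine le_max_of_le_left ?_
        nlinarith [hd (t₀ + k)]
      · refine le_max_of_le_right ?_
        rw [pow_succ', mul_assoc]
        gcongr
  have hgeo : Tendsto (fun k => κ' ^ k * d t₀) atTop (𝓝 0) := by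
    simpa using (tendsto_pow_atTop_nhds_zero_of_lt_one hκ'0.le hκ'1).mul_const (d t₀)
  obtain ⟨k₀, hk₀⟩ := eventually_atTop.1 (hgeo.eventually (gt_mem_nhds hδ0))
  refine ⟨t₀ + k₀, fun t ht => ?_⟩
  obtain ⟨k, rfl⟩ := Nat.exists_eq_add_of_le (le_trans (Nat.le_add_right t₀ k₀) ht)
  rw [Real.dist_eq, sub_zero, abs_of_nonneg (hd _)]
  refine lt_of_le_of_lt (hind k) (max_lt (by linarith) ?_)
  have := hk₀ k (by omega)
  linarith

/-- A sequence with increments between `α / (1 + K α / v)` and `v (exp (α / v) - 1)`, where `α`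
grows like a power, grows as if its increments were exactly `α`. -/
theorem tendsto_div_pow_succ_of_increment_bounds {v α : ℕ → ℝ} {n : ℕ} {G K : ℝ} (hK : 0 ≤ K)
    (hG : 0 < G) (hv : ∀ t, 0 < v t) (hα : ∀ t, 0 < α t)
    (hlim : Tendsto (fun t => α t / (t : ℝ) ^ n) atTop (𝓝 ((n + 1) * G)))
    (hlow : ∀ t, v t + α t / (1 + K * (α t / v t)) ≤ v (t + 1))
    (hupp : ∀ t, v (t + 1) ≤ v t * Real.exp (α t / v t)) :
    Tendsto (fun t => v t / (t : ℝ) ^ (n + 1)) atTop (𝓝 G) := by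
  have hd : ∀ t, 0 < α t / v t := fun t => div_pos (hα t) (hv t)
  have hratio : Tendsto (fun t => α (t + 1) / α t) atTop (𝓝 1) := by
    have h0 : ((n : ℝ) + 1) * G ≠ 0 := by positivity
    have h1 := ((hlim.comp (tendsto_add_atTop_nat 1)).div hlim h0).mul
      (tendsto_succ_div_self.pow n)
    rw [div_self h0, one_pow, one_mul] at h1
    refine h1.congr' ?_
    filter_upwards [eventually_gt_atTop 0] with t ht
    have := (hα t).ne'
    have ht' : (t : ℝ) ≠ 0 := by positivity
    have ht'' : (t : ℝ) + 1 ≠ 0 := by positivity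
    simp only [Pi.div_apply, Function.comp_apply, Nat.cast_add, Nat.cast_one, div_pow]
    field_simp
  -- Dividing `α (t + 1)` by the lower bound for `v (t + 1)` gives a self-contained recursion for `α
  -- t / v t`, so no prior growth estimate on `v` is needed.
  have hd0 : Tendsto (fun t => α t / v t) atTop (𝓝 0) := by
    refine tendsto_zero_of_le_mul_div_one_add hK (fun t => (hd t).le) hratio fun t => ?_
    have h1 := hv t
    have h2 := hα t
    have h3 := hd t
    have e : α (t + 1) / α t * (α t / v t / (1 + α t / v t / (1 + K * (α t / v t)))) =
        α (t + 1) / (v t + α t / (1 + K * (α t / v t))) := by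
      field_simp
    rw [e]
    have := hα (t + 1)
    exact div_le_div_of_nonneg_left this.le (by positivity) (hlow t)
  refine tendsto_div_pow_succ_of_tendsto_sub_div_pow ?_
  have hL : Tendsto (fun t => α t / (t : ℝ) ^ n / (1 + K * (α t / v t))) atTop
      (𝓝 ((n + 1) * G)) := by
    simpa [Pi.div_def] using hlim.div ((hd0.const_mul K).const_add 1) (by simp)
  have hU : Tendsto (fun t => α t / (t : ℝ) ^ n * Real.exp (α t / v t)) atTop
      (𝓝 ((n + 1) * G)) := by
    simpa using hlim.mul ((Real.continuous_exp.tendsto 0).comp hd0)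
  refine tendsto_of_tendsto_of_tendsto_of_le_of_le hL hU (fun t => ?_) fun t => ?_
  · change α t / (t : ℝ) ^ n / _ ≤ _
    rw [div_right_comm]
    gcongr
    linarith [hlow t]
  · change _ ≤ α t / (t : ℝ) ^ n * _
    rw [div_mul_eq_mul_div]
    gcongr
    -- This gives `exp x - 1 ≤ x * exp x`, which makes the upper bound on the increment `α t * exp
    -- (α t / v t)`.
    have h1 : 1 - Real.exp (-(α t / v t)) ≤ α t / v t := by
      linarith [Real.add_one_le_exp (-(α t / v t))]
    have h2 : v t * Real.exp (α t / v t) * (1 - Real.exp (-(α t / v t))) ≤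
        v t * Real.exp (α t / v t) * (α t / v t) :=
      mul_le_mul_of_nonneg_left h1 (mul_pos (hv t) (Real.exp_pos _)).le
    have h3 : v t * Real.exp (α t / v t) * (1 - Real.exp (-(α t / v t))) =
        v t * Real.exp (α t / v t) - v t := by
      rw [mul_sub, mul_one, mul_assoc, ← Real.exp_add, add_neg_cancel, Real.exp_zero, mul_one]
    have h4 : v t * Real.exp (α t / v t) * (α t / v t) = α t * Real.exp (α t / v t) := by
      have := (hv t).ne'
      field_simp
    linarith [hupp t]

/-! ### Expectation over types and bounds for the single-stage problem. -/

namespace UIPModel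

variable {ι Ω : Type*} (M : UIPModel ι Ω)

section Expectation

variable [Fintype Ω]

theorem expect_mono {g h : Ω → ℝ} (hgh : ∀ ω, g ω ≤ h ω) : M.expect g ≤ M.expect h :=
  Finset.sum_le_sum fun ω _ => mul_le_mul_of_nonneg_left (hgh ω) ENNReal.toReal_nonneg

theorem expect_const (c : ℝ) : M.expect (fun _ => c) = c := by
  have h : ∑ ω, (M.typeLaw ω).toReal = 1 := by
    rw [← ENNReal.toReal_sum fun ω _ => M.typeLaw.apply_ne_top ω,
      ← tsum_fintype (L := .unconditional Ω), M.typeLaw.tsum_coe, ENNReal.toReal_one]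
  rw [expect, ← Finset.sum_mul, h, one_mul]

theorem expect_mul_const (g : Ω → ℝ) (c : ℝ) :
    M.expect (fun ω => g ω * c) = M.expect g * c := by
  simp only [expect, Finset.sum_mul, mul_assoc]

theorem expect_const_mul (g : Ω → ℝ) (c : ℝ) :
    M.expect (fun ω => c * g ω) = c * M.expect g := by
  simp only [expect, Finset.mul_sum, mul_left_comm]

theorem expect_add (g h : Ω → ℝ) :
    M.expect (fun ω => g ω + h ω) = M.expect g + M.expect h := by
  simp only [expect, mul_add, Finset.sum_add_distrib]

theorem expect_sum (S : Finset ι) (g : ι → Ω → ℝ) :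
    M.expect (fun ω => ∑ i ∈ S, g i ω) = ∑ i ∈ S, M.expect (g i) := by
  simp only [expect, Finset.mul_sum]
  exact Finset.sum_comm

/-- Mean attraction value of an option over the customer types. -/
noncomputable def meanAttr (i : ι) : ℝ :=
  M.expect fun ω => Real.exp (M.quality ω i)

theorem meanAttr_pos (i : ι) : 0 < M.meanAttr i := by
  obtain ⟨ω, hω⟩ := M.typeLaw.support_nonempty
  have h : 0 < (M.typeLaw ω).toReal :=
    ENNReal.toReal_pos ((M.typeLaw.mem_support_iff ω).1 hω) (M.typeLaw.apply_ne_top ω)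
  exact Finset.sum_pos' (fun ω _ => mul_nonneg ENNReal.toReal_nonneg (Real.exp_pos _).le)
    ⟨ω, Finset.mem_univ _, mul_pos h (Real.exp_pos _)⟩

/-- Finitely many types and positive means allow `Q` to be the sum of all the ratios. This controls
the MNL denominators of every type by averaged quantities. -/
theorem exists_exp_quality_le (S : Finset ι) :
    ∃ Q : ℝ, 0 ≤ Q ∧ ∀ ω, ∀ i ∈ S, Real.exp (M.quality ω i) ≤ Q * M.meanAttr i := by
  have h0 : ∀ ω i, 0 ≤ Real.exp (M.quality ω i) / M.meanAttr i :=
    fun ω i => div_nonneg (Real.exp_pos _).le (M.meanAttr_pos i).le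
  refine ⟨∑ ω, ∑ i ∈ S, Real.exp (M.quality ω i) / M.meanAttr i,
    Finset.sum_nonneg fun ω _ => Finset.sum_nonneg fun i _ => h0 ω i, fun ω i hi => ?_⟩
  rw [← div_le_iff₀ (M.meanAttr_pos i)]
  calc Real.exp (M.quality ω i) / M.meanAttr i
      ≤ ∑ i ∈ S, Real.exp (M.quality ω i) / M.meanAttr i :=
        Finset.single_le_sum (f := fun i => Real.exp (M.quality ω i) / M.meanAttr i)
          (fun j _ => h0 ω j) hi
    _ ≤ _ := Finset.single_le_sum
          (f := fun ω => ∑ i ∈ S, Real.exp (M.quality ω i) / M.meanAttr i)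
          (fun ω _ => Finset.sum_nonneg fun j _ => h0 ω j) (Finset.mem_univ ω)

end Expectation

section Stage

theorem choiceProb_pos (ω : Ω) (S : Finset ι) (p : ι → ℝ) (i : ι) : 0 < M.choiceProb ω S p i :=
  div_pos (Real.exp_pos _) (M.denom_pos ω S p)

theorem sum_choiceProb_lt_one (ω : Ω) (S : Finset ι) (p : ι → ℝ) :
    ∑ i ∈ S, M.choiceProb ω S p i < 1 := by
  have h := M.sum_choiceProb ω S p
  have h' := one_div_pos.mpr (M.denom_pos ω S p)
  linarith

/-- Up to the factor `-1 / β`, the single-stage revenue at markup `-1 / β` when the no-purchase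
option dominates the market. -/
noncomputable def stageAttr (ω : Ω) (S : Finset ι) (Δ : ι → ℝ) : ℝ :=
  ∑ i ∈ S, Real.exp (M.quality ω i + M.beta * Δ i) * Real.exp (-1)

theorem stageAttr_nonneg (ω : Ω) (S : Finset ι) (Δ : ι → ℝ) : 0 ≤ M.stageAttr ω S Δ :=
  Finset.sum_nonneg fun _ _ => by positivity

/-- Dropping the denominator leaves `x * exp (-x)` with `x = -β (p i - d)`, whose maximum is `exp
(-1)` at `x = 1`. The bound serves both the Bellman recursion and the fluid dual, where `d` is
chosen differently. -/
theorem neg_beta_mul_choiceProb_mul_le (hβ : M.beta < 0) (ω : Ω) (S : Finset ι) (p : ι → ℝ)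
    (i : ι) (d : ℝ) :
    -M.beta * (M.choiceProb ω S p i * (p i - d)) ≤
      Real.exp (M.quality ω i + M.beta * d) * Real.exp (-1) := by
  have hd := M.denom_pos ω S p
  rcases le_or_gt (p i - d) 0 with h | h
  · have h1 : M.choiceProb ω S p i * (p i - d) ≤ 0 :=
      mul_nonpos_of_nonneg_of_nonpos (div_pos (Real.exp_pos _) hd).le h
    exact (mul_nonpos_of_nonneg_of_nonpos (by linarith) h1).trans (by positivity)
  · have h1 : M.choiceProb ω S p i ≤ Real.exp (M.quality ω i + M.beta * p i) := by
      refine div_le_self (Real.exp_pos _).le ?_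
      have : 0 ≤ ∑ j ∈ S, Real.exp (M.quality ω j + M.beta * p j) :=
        Finset.sum_nonneg fun j _ => (Real.exp_pos _).le
      linarith
    have h2 : 0 ≤ -M.beta * (p i - d) := mul_nonneg (by linarith) h.le
    calc -M.beta * (M.choiceProb ω S p i * (p i - d))
        = M.choiceProb ω S p i * (-M.beta * (p i - d)) := by ring
      _ ≤ Real.exp (M.quality ω i + M.beta * p i) * (-M.beta * (p i - d)) := by gcongr
      _ = Real.exp (M.quality ω i + M.beta * d) *
          (-M.beta * (p i - d) * Real.exp (-(-M.beta * (p i - d)))) := by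
        rw [show M.quality ω i + M.beta * p i =
          (M.quality ω i + M.beta * d) + -(-M.beta * (p i - d)) by ring, Real.exp_add]
        ring
      _ ≤ _ := by gcongr; exact Real.mul_exp_neg_le_exp_neg_one _

theorem neg_beta_mul_stageOpt_le (hβ : M.beta < 0) (ω : Ω) (S : Finset ι) (Δ : ι → ℝ) :
    -M.beta * M.stageOpt ω S Δ ≤ M.stageAttr ω S Δ := by
  have hb : 0 < -M.beta := by linarith
  rw [mul_comm, ← le_div_iff₀ hb]
  refine (M.isLUB_stageOpt hβ ω S Δ).2 ?_
  rintro _ ⟨p, rfl⟩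
  rw [le_div_iff₀ hb, mul_comm, stageRevenue, Finset.mul_sum]
  exact Finset.sum_le_sum fun i _ => M.neg_beta_mul_choiceProb_mul_le hβ ω S p i (Δ i)

/-- The common markup `1 / (-β)` maximizes every term of the upper bound simultaneously, so only the
MNL denominator `1 + A` is lost. -/
theorem le_neg_beta_mul_stageOpt (hβ : M.beta < 0) (ω : Ω) (S : Finset ι) (Δ : ι → ℝ) :
    M.stageAttr ω S Δ / (1 + M.stageAttr ω S Δ) ≤ -M.beta * M.stageOpt ω S Δ := by
  have hb : 0 < -M.beta := by linarith
  have h := (M.isLUB_stageOpt hβ ω S Δ).1 ⟨fun i => Δ i + 1 / (-M.beta), rfl⟩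
  refine le_trans (le_of_eq ?_) (mul_le_mul_of_nonneg_left h hb.le)
  have e : ∀ i, Real.exp (M.quality ω i + M.beta * (Δ i + 1 / (-M.beta))) =
      Real.exp (M.quality ω i + M.beta * Δ i) * Real.exp (-1) := by
    intro i
    rw [← Real.exp_add]
    congr 1
    have := hβ.ne
    field_simp
    ring
  simp only [stageRevenue, choiceProb, e, add_sub_cancel_left, ← Finset.sum_mul,
    ← Finset.sum_div, stageAttr]
  have := hβ.ne
  field_simp

end Stage

end UIPModel

/-! ### Growth of the value function. -/

namespace UIPModel

variable {ι Ω : Type*} (M : UIPModel ι Ω)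

section DynamicProgram

variable [Fintype Ω] [DecidableEq ι]

/-- Exponential of the value function in the units in which the price sensitivity is `-1`. -/
noncomputable def expValue (t : ℕ) (S : Finset ι) : ℝ :=
  Real.exp (-M.beta * M.optValue t S)

/-- First-order approximation of the increments of `expValue`. -/
noncomputable def expValueRate (t : ℕ) (S : Finset ι) : ℝ :=
  ∑ i ∈ S, M.mu * M.meanAttr i / Real.exp 1 * M.expValue t (S.erase i)

theorem expValue_pos (t : ℕ) (S : Finset ι) : 0 < M.expValue t S :=
  Real.exp_pos _

theorem stageAttr_optValue (t : ℕ) (S : Finset ι) (ω : Ω) :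
    M.stageAttr ω S (fun i => M.optValue t S - M.optValue t (S.erase i)) =
      ∑ i ∈ S, Real.exp (M.quality ω i) *
        (M.expValue t (S.erase i) / M.expValue t S / Real.exp 1) := by
  refine Finset.sum_congr rfl fun i _ => ?_
  rw [expValue, expValue, ← Real.exp_sub, ← Real.exp_sub, ← Real.exp_add, ← Real.exp_add]
  congr 1
  ring

theorem mu_mul_expect_stageAttr_optValue (t : ℕ) (S : Finset ι) :
    M.mu * M.expect (fun ω =>
      M.stageAttr ω S fun i => M.optValue t S - M.optValue t (S.erase i)) =
      M.expValueRate t S / M.expValue t S := by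
  simp only [stageAttr_optValue, expect_sum, expect_mul_const]
  rw [expValueRate, Finset.mul_sum, Finset.sum_div]
  refine Finset.sum_congr rfl fun i _ => ?_
  rw [meanAttr]
  ring

theorem neg_beta_mul_optValue_succ (t : ℕ) (S : Finset ι) :
    -M.beta * M.optValue (t + 1) S = -M.beta * M.optValue t S +
      M.mu * M.expect (fun ω => -M.beta *
        M.stageOpt ω S fun i => M.optValue t S - M.optValue t (S.erase i)) := by
  rw [optValue, expect_const_mul]
  ring

theorem expValue_succ_le (hμ : 0 < M.mu) (hβ : M.beta < 0) (t : ℕ) (S : Finset ι) :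
    M.expValue (t + 1) S ≤
      M.expValue t S * Real.exp (M.expValueRate t S / M.expValue t S) := by
  rw [← mu_mul_expect_stageAttr_optValue, expValue, expValue, ← Real.exp_add, Real.exp_le_exp,
    neg_beta_mul_optValue_succ]
  gcongr
  exact M.expect_mono fun ω => M.neg_beta_mul_stageOpt_le hβ ω S _

/-- The bound `A ω ≤ Q * E[A]` turns `E[A / (1 + A)]` into a function of `E[A]` alone, and `1 + x ≤
exp x` removes the exponential. It matters that `K` does not depend on `t`: the correction then
disappears as the relative rate tends to zero. -/
theorem exists_le_expValue_succ (hμ : 0 < M.mu) (hβ : M.beta < 0) (S : Finset ι) :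
    ∃ K : ℝ, 0 ≤ K ∧ ∀ t, M.expValue t S + M.expValueRate t S /
      (1 + K * (M.expValueRate t S / M.expValue t S)) ≤ M.expValue (t + 1) S := by
  obtain ⟨Q, hQ0, hQ⟩ := M.exists_exp_quality_le S
  refine ⟨Q / M.mu, by positivity, fun t => ?_⟩
  have hv := M.expValue_pos t S
  set A : Ω → ℝ := fun ω =>
    M.stageAttr ω S fun i => M.optValue t S - M.optValue t (S.erase i) with hA
  have hA0 : ∀ ω, 0 ≤ A ω := fun ω => M.stageAttr_nonneg ω S _
  have hEA0 : 0 ≤ M.expect A := by simpa [expect_const] using M.expect_mono hA0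
  have hEA : M.expValueRate t S / M.expValue t S = M.mu * M.expect A :=
    (M.mu_mul_expect_stageAttr_optValue t S).symm
  have hAQ : ∀ ω, A ω ≤ Q * M.expect A := by
    intro ω
    simp only [hA, stageAttr_optValue, expect_sum, expect_mul_const, Finset.mul_sum]
    refine Finset.sum_le_sum fun i hi => ?_
    rw [← mul_assoc]
    refine mul_le_mul_of_nonneg_right (hQ ω i hi) ?_
    have := M.expValue_pos t (S.erase i)
    positivity
  have hE : M.expect A / (1 + Q * M.expect A) ≤ M.expect fun ω => -M.beta *
      M.stageOpt ω S fun i => M.optValue t S - M.optValue t (S.erase i) := by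
    rw [div_eq_mul_inv, ← expect_mul_const]
    refine M.expect_mono fun ω => le_trans ?_ (M.le_neg_beta_mul_stageOpt hβ ω S _)
    rw [← div_eq_mul_inv]
    have := hA0 ω
    exact div_le_div_of_nonneg_left this (by positivity) (by linarith [hAQ ω])
  have hrate : M.expValueRate t S = M.expValue t S * (M.mu * M.expect A) := by
    rw [← hEA]
    field_simp
  have hKA : Q / M.mu * (M.mu * M.expect A) = Q * M.expect A := by field_simp
  rw [hEA, hKA, hrate]
  calc M.expValue t S + M.expValue t S * (M.mu * M.expect A) / (1 + Q * M.expect A)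
      = M.expValue t S * (M.mu * (M.expect A / (1 + Q * M.expect A)) + 1) := by ring
    _ ≤ M.expValue t S * Real.exp (M.mu * (M.expect A / (1 + Q * M.expect A))) := by
        gcongr
        exact Real.add_one_le_exp _
    _ ≤ M.expValue t S * Real.exp (M.mu * M.expect fun ω => -M.beta *
          M.stageOpt ω S fun i => M.optValue t S - M.optValue t (S.erase i)) := by gcongr
    _ = M.expValue (t + 1) S := by
        rw [expValue, expValue, ← Real.exp_add, neg_beta_mul_optValue_succ]

theorem optValue_empty (t : ℕ) : M.optValue t ∅ = 0 := by
  induction t with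
  | zero => simp [optValue]
  | succ t ih =>
    have h : ∀ (ω : Ω) (Δ : ι → ℝ), M.stageOpt ω ∅ Δ = 0 := by
      intro ω Δ
      have : M.stageRevenue ω ∅ Δ = fun _ => 0 := by
        funext p
        simp [stageRevenue]
      rw [stageOpt, this, Set.range_const, csSup_singleton]
    rw [optValue, ih]
    simp [h, expect]

/-- By induction, each `S.erase i` contributes to the rate a multiple of `t ^ (|S| - 1)` with the
product over `S` without `i`; the prefactor restores the missing factor. The `|S|` summands thus
have the same limit, and this multiplicity cancels against the factor `|S|` from summing `t ^ (|S| -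
1)`. -/
theorem tendsto_expValue_div_pow (hμ : 0 < M.mu) (hβ : M.beta < 0) (S : Finset ι) :
    Tendsto (fun t => M.expValue t S / (t : ℝ) ^ S.card) atTop
      (𝓝 (∏ i ∈ S, M.mu * M.meanAttr i / Real.exp 1)) := by
  induction S using Finset.strongInduction with
  | H S ih =>
  have hc : ∀ i, 0 < M.mu * M.meanAttr i / Real.exp 1 := fun i =>
    div_pos (mul_pos hμ (M.meanAttr_pos i)) (Real.exp_pos _)
  rcases S.eq_empty_or_nonempty with rfl | hS
  · simp [expValue, optValue_empty]
  obtain ⟨n, hn⟩ : ∃ n, S.card = n + 1 := Nat.exists_eq_succ_of_ne_zero hS.card_pos.ne'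
  obtain ⟨K, hK, hlow⟩ := M.exists_le_expValue_succ hμ hβ S
  rw [hn]
  refine tendsto_div_pow_succ_of_increment_bounds (α := fun t => M.expValueRate t S) hK
    (Finset.prod_pos fun i _ => hc i) (fun t => M.expValue_pos t S)
    (fun t => Finset.sum_pos (fun i _ => mul_pos (hc i) (M.expValue_pos t _)) hS) ?_ hlow
    fun t => M.expValue_succ_le hμ hβ t S
  have h : ∀ i ∈ S, Tendsto (fun t : ℕ => M.mu * M.meanAttr i / Real.exp 1 *
      (M.expValue t (S.erase i) / (t : ℝ) ^ n)) atTop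
      (𝓝 (∏ i ∈ S, M.mu * M.meanAttr i / Real.exp 1)) := by
    intro i hi
    rw [← Finset.mul_prod_erase S _ hi]
    have := ih (S.erase i) (Finset.erase_ssubset hi)
    rw [Finset.card_erase_of_mem hi, hn, Nat.add_sub_cancel] at this
    exact this.const_mul _
  have hs := tendsto_finsetSum S h
  rw [Finset.sum_const, hn, nsmul_eq_mul, Nat.cast_add, Nat.cast_one] at hs
  refine hs.congr fun t => ?_
  simp only [expValueRate, Finset.sum_div, mul_div_assoc]

/-- Logarithmic growth of the value function. -/
theorem tendsto_neg_beta_mul_optValue_sub (hμ : 0 < M.mu) (hβ : M.beta < 0) (S : Finset ι) :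
    Tendsto (fun t : ℕ => -M.beta * M.optValue t S -
      ∑ i ∈ S, Real.log (M.mu * t * M.meanAttr i)) atTop (𝓝 (-(S.card : ℝ))) := by
  have hc : ∀ i, 0 < M.mu * M.meanAttr i / Real.exp 1 := fun i =>
    div_pos (mul_pos hμ (M.meanAttr_pos i)) (Real.exp_pos _)
  have h := (M.tendsto_expValue_div_pow hμ hβ S).log (Finset.prod_pos fun i _ => hc i).ne'
  have h2 := h.sub_const (∑ i ∈ S, Real.log (M.mu * M.meanAttr i))
  have e : Real.log (∏ i ∈ S, M.mu * M.meanAttr i / Real.exp 1) -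
      ∑ i ∈ S, Real.log (M.mu * M.meanAttr i) = -(S.card : ℝ) := by
    rw [Real.log_prod fun i _ => (hc i).ne', ← Finset.sum_sub_distrib]
    have : ∀ i ∈ S, Real.log (M.mu * M.meanAttr i / Real.exp 1) -
        Real.log (M.mu * M.meanAttr i) = -1 := by
      intro i _
      rw [Real.log_div (mul_pos hμ (M.meanAttr_pos i)).ne' (Real.exp_ne_zero _), Real.log_exp]
      ring
    rw [Finset.sum_congr rfl this]
    simp
  rw [e] at h2
  refine h2.congr' ?_
  filter_upwards [eventually_gt_atTop 0] with t ht
  have ht' : (t : ℝ) ≠ 0 := by positivity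
  have h3 : ∀ i ∈ S, Real.log (M.mu * t * M.meanAttr i) =
      Real.log t + Real.log (M.mu * M.meanAttr i) := by
    intro i _
    rw [← Real.log_mul ht' (mul_pos hμ (M.meanAttr_pos i)).ne']
    congr 1
    ring
  rw [Finset.sum_congr rfl h3, Finset.sum_add_distrib, Finset.sum_const, nsmul_eq_mul,
    Real.log_div (M.expValue_pos t S).ne' (pow_ne_zero _ ht'), Real.log_pow, expValue,
    Real.log_exp]
  ring

end DynamicProgram

end UIPModel

/-! ### Growth of the fluid value. -/

namespace UIPModel

variable {ι Ω : Type*} (M : UIPModel ι Ω)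

section Fluid

variable [Fintype Ω]

theorem neg_beta_mul_fluidObjective (S : Finset ι) (T : ℕ) (p ρ : Ω → ι → ℝ) :
    -M.beta * M.fluidObjective S T p ρ = ∑ i ∈ S,
      (M.mu * T * M.expect (fun ω => -M.beta * (ρ ω i * (p ω i - M.salvage i))) +
        -M.beta * M.salvage i) := by
  simp only [fluidObjective, expect_const_mul, Finset.sum_add_distrib, mul_add, Finset.mul_sum]
  congr 1
  exact Finset.sum_congr rfl fun i _ => by ring

/-- Weak duality: the inventory constraint of option `i` receives the multiplier `l - b ξ_i`, whose
nonnegativity is `hT`. With marginal value `l / b`, the relaxed revenue of each option is at most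
`1`, and `1 + l` is the logarithm. -/
theorem neg_beta_mul_fluidObjective_le (hβ : M.beta < 0) {S : Finset ι} {T : ℕ}
    (hx : 0 < M.mu * T)
    (hT : ∀ i ∈ S, -M.beta * M.salvage i ≤ Real.log (M.mu * T * M.meanAttr i) - 1)
    {p ρ : Ω → ι → ℝ} (hρ : M.FluidFeasible S T ρ) (hp : M.Induces S p ρ) :
    -M.beta * M.fluidObjective S T p ρ ≤ ∑ i ∈ S, Real.log (M.mu * T * M.meanAttr i) := by
  rw [neg_beta_mul_fluidObjective]
  refine Finset.sum_le_sum fun i hi => ?_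
  have hb : 0 < -M.beta := by linarith
  have hC := M.meanAttr_pos i
  -- The `-1` makes `l / b` plus the optimal markup `1 / b` equal to the market-clearing price.
  set l := Real.log (M.mu * T * M.meanAttr i) - 1 with hl
  have hstep : ∀ ω, -M.beta * (ρ ω i * (p ω i - M.salvage i)) ≤
      Real.exp (M.quality ω i) * (Real.exp (-l) * Real.exp (-1)) +
        ρ ω i * (l - -M.beta * M.salvage i) := by
    intro ω
    have h := M.neg_beta_mul_choiceProb_mul_le hβ ω S (p ω) i (l / (-M.beta))
    rw [hp ω i hi, show M.beta * (l / (-M.beta)) = -l by have := hβ.ne; field_simp,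
      Real.exp_add] at h
    have e : -M.beta * (ρ ω i * (p ω i - l / (-M.beta))) =
        -M.beta * (ρ ω i * p ω i) - ρ ω i * l := by
      have := hβ.ne
      field_simp
      ring
    rw [e] at h
    linarith
  have hE := M.expect_mono hstep
  rw [expect_add, expect_mul_const, expect_mul_const, ← meanAttr] at hE
  have hexp : M.mu * T * (M.meanAttr i * (Real.exp (-l) * Real.exp (-1))) = 1 := by
    rw [← Real.exp_add, show -l + -1 = -Real.log (M.mu * T * M.meanAttr i) by rw [hl]; ring,
      Real.exp_neg, Real.exp_log (mul_pos hx hC)]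
    field_simp
    exact div_self hx.ne'
  have hinv := mul_le_mul_of_nonneg_right (hρ.inventory i hi) (sub_nonneg.2 (hT i hi))
  have := mul_le_mul_of_nonneg_left hE hx.le
  rw [mul_add, hexp] at this
  linarith

theorem neg_beta_mul_fluidValue_le (hμ : 0 < M.mu) (hβ : M.beta < 0) {S : Finset ι} {T : ℕ}
    (hx : 0 < M.mu * T)
    (hT : ∀ i ∈ S, -M.beta * M.salvage i ≤ Real.log (M.mu * T * M.meanAttr i) - 1) :
    -M.beta * M.fluidValue S T ≤ ∑ i ∈ S, Real.log (M.mu * T * M.meanAttr i) := by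
  have hb : 0 < -M.beta := by linarith
  rw [mul_comm, ← le_div_iff₀ hb]
  refine (M.isLUB_fluidValue hμ hβ S T).2 ?_
  rintro _ ⟨ρ, p, hρ, hp, rfl⟩
  rw [le_div_iff₀ hb, mul_comm]
  exact M.neg_beta_mul_fluidObjective_le hβ hx hT hρ hp

/-- Constant prices at which every option is expected to be sold almost once. -/
noncomputable def clearingPrice (T : ℕ) (i : ι) : ℝ :=
  Real.log (M.mu * T * M.meanAttr i) / (-M.beta)

theorem exp_quality_add_clearingPrice (hβ : M.beta < 0) {T : ℕ} (hx : 0 < M.mu * T) (ω : Ω)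
    (i : ι) : Real.exp (M.quality ω i + M.beta * M.clearingPrice T i) =
      Real.exp (M.quality ω i) / (M.mu * T * M.meanAttr i) := by
  have e : M.beta * M.clearingPrice T i = -Real.log (M.mu * T * M.meanAttr i) := by
    have := hβ.ne
    rw [clearingPrice]
    field_simp
  rw [e, Real.exp_add, Real.exp_neg, Real.exp_log (mul_pos hx (M.meanAttr_pos i)),
    div_eq_mul_inv]

/-- Without the MNL denominator, expected sales would be exactly `1`; the denominator only reduces
them. -/
theorem mul_expect_choiceProb_clearingPrice_le (hβ : M.beta < 0) (S : Finset ι) {T : ℕ}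
    (hx : 0 < M.mu * T) (i : ι) :
    M.mu * T * M.expect (fun ω => M.choiceProb ω S (M.clearingPrice T) i) ≤ 1 := by
  have hC := M.meanAttr_pos i
  have h : ∀ ω, M.choiceProb ω S (M.clearingPrice T) i ≤
      Real.exp (M.quality ω i) * (M.mu * T * M.meanAttr i)⁻¹ := by
    intro ω
    rw [← div_eq_mul_inv, ← M.exp_quality_add_clearingPrice hβ hx]
    refine div_le_self (Real.exp_pos _).le ?_
    have : 0 ≤ ∑ j ∈ S, Real.exp (M.quality ω j + M.beta * M.clearingPrice T j) :=
      Finset.sum_nonneg fun j _ => (Real.exp_pos _).le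
    linarith
  refine (mul_le_mul_of_nonneg_left (M.expect_mono h) hx.le).trans (le_of_eq ?_)
  rw [expect_mul_const, ← meanAttr]
  field_simp
  exact div_self hx.ne'

/-- All attraction values are `O(1 / T)` at these prices, so each denominator is at most `1 + s`,
and `1 / (1 + s) ≥ 1 - s`. -/
theorem le_mul_expect_choiceProb_clearingPrice (hβ : M.beta < 0) {S : Finset ι} {T : ℕ}
    (hx : 0 < M.mu * T) {Q : ℝ} (hQ0 : 0 ≤ Q)
    (hQ : ∀ ω, ∀ i ∈ S, Real.exp (M.quality ω i) ≤ Q * M.meanAttr i) (i : ι) :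
    1 - S.card * Q / (M.mu * T) ≤
      M.mu * T * M.expect (fun ω => M.choiceProb ω S (M.clearingPrice T) i) := by
  have hC := M.meanAttr_pos i
  set s := S.card * Q / (M.mu * T) with hs
  have hs0 : 0 ≤ s := by positivity
  have h : ∀ ω, Real.exp (M.quality ω i) * ((M.mu * T * M.meanAttr i)⁻¹ * (1 + s)⁻¹) ≤
      M.choiceProb ω S (M.clearingPrice T) i := by
    intro ω
    have hsum : ∑ j ∈ S, Real.exp (M.quality ω j + M.beta * M.clearingPrice T j) ≤ s := by
      have hj : ∀ j ∈ S, Real.exp (M.quality ω j + M.beta * M.clearingPrice T j) ≤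
          Q / (M.mu * T) := by
        intro j hj
        rw [M.exp_quality_add_clearingPrice hβ hx,
          div_le_div_iff₀ (mul_pos hx (M.meanAttr_pos j)) hx]
        have := mul_le_mul_of_nonneg_right (hQ ω j hj) hx.le
        linarith
      refine (Finset.sum_le_card_nsmul S _ _ hj).trans (le_of_eq ?_)
      rw [nsmul_eq_mul, hs, mul_div_assoc]
    rw [choiceProb, M.exp_quality_add_clearingPrice hβ hx, ← mul_assoc, ← div_eq_mul_inv,
      ← div_eq_mul_inv]
    exact div_le_div_of_nonneg_left (by positivity)
      (M.denom_pos ω S _) (by linarith)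
  refine le_trans ?_ (mul_le_mul_of_nonneg_left (M.expect_mono h) hx.le)
  rw [expect_mul_const, ← meanAttr]
  have e : M.mu * T * (M.meanAttr i * ((M.mu * T * M.meanAttr i)⁻¹ * (1 + s)⁻¹)) =
      1 / (1 + s) := by
    field_simp
    exact div_self hx.ne'
  rw [e, le_div_iff₀ (by linarith)]
  nlinarith

theorem fluidFeasible_clearingPrice (hβ : M.beta < 0) (S : Finset ι) {T : ℕ}
    (hx : 0 < M.mu * T) :
    M.FluidFeasible S T fun ω => M.choiceProb ω S (M.clearingPrice T) where
  mem_Ioo ω i hi := ⟨M.choiceProb_pos ω S _ i, lt_of_le_of_lt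
    (Finset.single_le_sum (f := fun i => M.choiceProb ω S (M.clearingPrice T) i)
      (fun j _ => (M.choiceProb_pos ω S _ j).le) hi) (M.sum_choiceProb_lt_one ω S _)⟩
  inventory i _ := M.mul_expect_choiceProb_clearingPrice_le hβ S hx i
  sum_le_one ω := (M.sum_choiceProb_lt_one ω S _).le

/-- The subtracted sum is the missed sales fraction times the scaled margin over salvage, of order
`log T / T`. -/
theorem le_neg_beta_mul_fluidValue (hμ : 0 < M.mu) (hβ : M.beta < 0) {S : Finset ι} {T : ℕ}
    (hx : 0 < M.mu * T)
    (hT : ∀ i ∈ S, -M.beta * M.salvage i ≤ Real.log (M.mu * T * M.meanAttr i) - 1)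
    {Q : ℝ} (hQ0 : 0 ≤ Q)
    (hQ : ∀ ω, ∀ i ∈ S, Real.exp (M.quality ω i) ≤ Q * M.meanAttr i) :
    ∑ i ∈ S, Real.log (M.mu * T * M.meanAttr i) - ∑ i ∈ S, S.card * Q / (M.mu * T) *
      (Real.log (M.mu * T * M.meanAttr i) - -M.beta * M.salvage i) ≤
      -M.beta * M.fluidValue S T := by
  have hb : 0 < -M.beta := by linarith
  have h := (M.isLUB_fluidValue hμ hβ S T).1
    ⟨_, fun _ => M.clearingPrice T, M.fluidFeasible_clearingPrice hβ S hx,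
      fun _ _ _ => rfl, rfl⟩
  refine le_trans ?_ (mul_le_mul_of_nonneg_left h hb.le)
  rw [neg_beta_mul_fluidObjective, ← Finset.sum_sub_distrib]
  refine Finset.sum_le_sum fun i hi => ?_
  have e : ∀ ω, -M.beta * (M.choiceProb ω S (M.clearingPrice T) i *
      (M.clearingPrice T i - M.salvage i)) = M.choiceProb ω S (M.clearingPrice T) i *
      (Real.log (M.mu * T * M.meanAttr i) - -M.beta * M.salvage i) := by
    intro ω
    have : -M.beta * M.clearingPrice T i = Real.log (M.mu * T * M.meanAttr i) :=
      mul_div_cancel₀ _ hb.ne'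
    rw [← this]
    ring
  simp only [e, expect_mul_const]
  have h1 := M.le_mul_expect_choiceProb_clearingPrice hβ hx hQ0 hQ i
  have h2 : 0 ≤ Real.log (M.mu * T * M.meanAttr i) - -M.beta * M.salvage i := by
    linarith [hT i hi]
  have h3 := mul_le_mul_of_nonneg_right h1 h2
  linarith

theorem tendsto_log_mul_meanAttr (hμ : 0 < M.mu) (i : ι) :
    Tendsto (fun T : ℕ => Real.log (M.mu * T * M.meanAttr i)) atTop atTop :=
  Real.tendsto_log_atTop.comp <| (tendsto_natCast_atTop_atTop.const_mul_atTop hμ).atTop_mul_const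
    (M.meanAttr_pos i)

theorem tendsto_log_mul_meanAttr_div (hμ : 0 < M.mu) (i : ι) (c d : ℝ) :
    Tendsto (fun T : ℕ => c / (M.mu * T) * (Real.log (M.mu * T * M.meanAttr i) - d)) atTop
      (𝓝 0) := by
  have hC := M.meanAttr_pos i
  have hx : Tendsto (fun T : ℕ => M.mu * T * M.meanAttr i) atTop atTop :=
    (tendsto_natCast_atTop_atTop.const_mul_atTop hμ).atTop_mul_const hC
  have h1 := (Real.isLittleO_log_id_atTop.tendsto_div_nhds_zero.comp hx).sub (hx.const_div_atTop d)
  have h2 := h1.const_mul (c * M.meanAttr i)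
  rw [sub_zero, mul_zero] at h2
  refine h2.congr' ?_
  filter_upwards [eventually_gt_atTop 0] with T hT
  have : (T : ℝ) ≠ 0 := by positivity
  simp only [Function.comp_apply, id]
  field_simp

/-- Logarithmic growth of the fluid value. -/
theorem tendsto_neg_beta_mul_fluidValue_sub (hμ : 0 < M.mu) (hβ : M.beta < 0) (S : Finset ι) :
    Tendsto (fun T : ℕ => -M.beta * M.fluidValue S T -
      ∑ i ∈ S, Real.log (M.mu * T * M.meanAttr i)) atTop (𝓝 0) := by
  obtain ⟨Q, hQ0, hQ⟩ := M.exists_exp_quality_le S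
  have hlow : Tendsto (fun T : ℕ => -∑ i ∈ S, S.card * Q / (M.mu * T) *
      (Real.log (M.mu * T * M.meanAttr i) - -M.beta * M.salvage i)) atTop (𝓝 0) := by
    have := (tendsto_finsetSum S fun i _ =>
      M.tendsto_log_mul_meanAttr_div hμ i (S.card * Q) (-M.beta * M.salvage i)).neg
    simpa only [Finset.sum_const_zero, neg_zero] using this
  have hev : ∀ᶠ T : ℕ in atTop, ∀ i ∈ S,
      -M.beta * M.salvage i ≤ Real.log (M.mu * T * M.meanAttr i) - 1 := by
    rw [Filter.eventually_all_finset]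
    intro i _
    filter_upwards [(M.tendsto_log_mul_meanAttr hμ i).eventually_ge_atTop
      (-M.beta * M.salvage i + 1)] with T hT
    linarith
  refine tendsto_of_tendsto_of_tendsto_of_le_of_le' hlow tendsto_const_nhds ?_ ?_
  · filter_upwards [hev, eventually_gt_atTop 0] with T hT hT0
    have := M.le_neg_beta_mul_fluidValue hμ hβ (mul_pos hμ (Nat.cast_pos.2 hT0)) hT hQ0 hQ
    linarith
  · filter_upwards [hev, eventually_gt_atTop 0] with T hT hT0
    have := M.neg_beta_mul_fluidValue_le hμ hβ (mul_pos hμ (Nat.cast_pos.2 hT0)) hT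
    linarith

end Fluid

/-! ### Comparison of the two expansions. -/

theorem tendsto_fluidValue_sub_optValue [Fintype Ω] [DecidableEq ι] (hμ : 0 < M.mu)
    (hβ : M.beta < 0) (S : Finset ι) :
    Tendsto (fun T : ℕ => M.fluidValue S T - M.optValue T S) atTop
      (𝓝 (-((S.card : ℝ) / M.beta))) := by
  have h := ((M.tendsto_neg_beta_mul_fluidValue_sub hμ hβ S).sub
    (M.tendsto_neg_beta_mul_optValue_sub hμ hβ S)).div_const (-M.beta)
  have hb := hβ.ne
  rw [zero_sub, neg_neg, div_neg] at h
  refine h.congr fun T => ?_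
  field_simp
  ring

end UIPModel

theorem mainTheorem7 {ι Ω : Type*} [DecidableEq ι] [Fintype Ω] (M : UIPModel ι Ω)
    (hμ_pos : 0 < M.mu) (hμ_le : M.mu ≤ 1) (hβ : M.beta < 0)
    (S : Finset ι) (hS : S.Nonempty) :
    ¬ Tendsto (fun T : ℕ => M.fluidValue S T - M.optValue T S) atTop (𝓝 0) ∧
    (∃ l : ℝ, Tendsto (fun T : ℕ => M.fluidValue S T - M.optValue T S) atTop (𝓝 l) ∧
      -((S.card : ℝ) / M.beta) ≤ l) ∧
    0 < -((S.card : ℝ) / M.beta) := by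
  have h := M.tendsto_fluidValue_sub_optValue hμ_pos hβ S
  have hpos : 0 < -((S.card : ℝ) / M.beta) :=
    neg_pos.2 (div_neg_of_pos_of_neg (Nat.cast_pos.2 hS.card_pos) hβ)
  exact ⟨fun h0 => hpos.ne (tendsto_nhds_unique h0 h), ⟨_, h, le_rfl⟩, hpos⟩
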